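/- All lattices are finite and nonempty, $\prec$ is the cover relation, and $x^{\uparrow}$, $x_{\downarrow}$ denote the sets of upper and lower covers of $x$. The elements of each lattice carry distinct labels from a linearly ordered set. An element $x$ is doubly irreducible if $|x^{\uparrow}|=|x_{\downarrow}|=1$. A decoration site is a pair $(a,b)$ of elements with $a^{\uparrow}=b_{\downarrow}$ and $|a^{\uparrow}|\ge 2$; its trinkets are the $\min(d,|a^{\uparrow}|-2)$ highest-labeled doubly irreducible elements between $a$ and $b$, where $d$ is the number of doubly irreducible elements between $a$ and $b$. A rack is a lattice that contains no trinkets. A lattice is planar if it has a planar Hasse diagram, that is, if its elements can be drawn as distinct points of the plane so that for all $x\prec y$ the point of $x$ is lower than that of $y$, the straight line segment joining them contains the point of no other element, and two such segments, for different cover pairs, meet at most in the point of a common end. **Corollary.** Every planar modular rack is distributive. -/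

import Mathlib

namespace LatticeRack

section Order

variable {L : Type*} [Lattice L]

/-- The set of upper covers of `x`. -/
def upperCovers (x : L) : Set L := {y | x ⋖ y}

/-- The set of lower covers of `x`. -/
def lowerCovers (x : L) : Set L := {y | y ⋖ x}

/-- An element is doubly irreducible if it has exactly one upper cover and exactly one
lower cover. -/
def IsDoublyIrreducible (x : L) : Prop :=
  (upperCovers x).ncard = 1 ∧ (lowerCovers x).ncard = 1

/-- A decoration site is a pair `(a, b)` such that the upper covers of `a` are exactly the
lower covers of `b`, and there are at least two of them. -/
def IsDecorationSite (a b : L) : Prop :=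
  upperCovers a = lowerCovers b ∧ 2 ≤ (upperCovers a).ncard

/-- The doubly irreducible elements between `a` and `b`. -/
def doublyIrreduciblesBetween (a b : L) : Set L :=
  {t | t ∈ Set.Ioo a b ∧ IsDoublyIrreducible t}

/-- The trinkets of a decoration site `(a, b)`: with `d` the number of doubly irreducible
elements between `a` and `b`, and `k` the number of upper covers of `a`, these are the
`min d (k - 2)` highest-labeled doubly irreducible elements between `a` and `b`, that is, those
for which fewer than `min d (k - 2)` of the others have a higher label.  The intrinsic linear
order of the elements is given by an injective labeling by a linearly ordered type. -/
def trinkets {ι : Type*} [LinearOrder ι] (label : L ↪ ι) (a b : L) : Set L :=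
  {t | t ∈ doublyIrreduciblesBetween a b ∧
    {s | s ∈ doublyIrreduciblesBetween a b ∧ label t < label s}.ncard <
      min (doublyIrreduciblesBetween a b).ncard ((upperCovers a).ncard - 2)}

/-- A rack is a lattice that contains no trinkets: no decoration site has any. -/
def IsRack {ι : Type*} [LinearOrder ι] (label : L ↪ ι) : Prop :=
  ∀ a b : L, IsDecorationSite a b → trinkets label a b = ∅

/-- A planar (Hasse) diagram of `L`: the elements are distinct points of the plane, every cover
pair is joined by a straight line segment that goes strictly upwards and passes through no
point of any further element, and the segments of two different cover pairs meet at most in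
the point of a common end. -/
structure IsPlanarDiagram (p : L → ℝ × ℝ) : Prop where
  injective : Function.Injective p
  upward : ∀ a b : L, a ⋖ b → (p a).2 < (p b).2
  avoids : ∀ a b c : L, a ⋖ b → c ≠ a → c ≠ b → p c ∉ segment ℝ (p a) (p b)
  noncrossing : ∀ a b c d : L, a ⋖ b → c ⋖ d → (a, b) ≠ (c, d) →
    segment ℝ (p a) (p b) ∩ segment ℝ (p c) (p d) ⊆ p '' (({a, b} : Set L) ∩ {c, d})

end Order

/-- A (finite) lattice is planar if it has a planar diagram. -/
def IsPlanar (L : Type*) [Lattice L] : Prop :=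
  ∃ p : L → ℝ × ℝ, IsPlanarDiagram p

end LatticeRack

/-! If distributivity fails in a finite modular lattice, some element `o` has three upper covers
`x`, `y`, `z`. Near `o` one of the three edges, say that of `y`, is drawn between the others. A
maximal chain through `o` and `y` is drawn as a curve separating `x` from `z`, and an edge can meet
this curve only at elements of the chain. By modularity `i = x ⊔ z` covers both `x` and `z`, so `i`
lies on every such chain. This forces `y` to be doubly irreducible with covers `o` and `i`, and
makes all pairwise joins equal to `i`. Together with the dual argument, `(o, i)` is a decoration
site with at least three upper covers and a doubly irreducible element in between, so it has a
trinket, which a rack forbids. -/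

namespace LatticeRack

open scoped Pointwise

/-! ### Modular lattices: from non-distributivity to three covers. -/

section Modular

variable {L : Type*} [Lattice L] [IsModularLattice L]

/-- A modular lattice in which distributivity fails has three elements that are strictly above
their common pairwise meet. -/
theorem exists_three_of_not_distrib {x y z : L} (h : x ⊓ (y ⊔ z) ≠ (x ⊓ y) ⊔ (x ⊓ z)) :
    ∃ m a b c : L, m < a ∧ m < b ∧ m < c ∧ a ⊓ b = m ∧ a ⊓ c = m ∧ b ⊓ c = m := by
  set s := (x ⊓ y) ⊔ (x ⊓ z) with hs
  set u := x ⊓ (y ⊔ z) with hu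
  set b := y ⊔ (x ⊓ z) with hb
  set c := z ⊔ (x ⊓ y) with hc
  have hsu : s ≤ u := by
    refine sup_le (le_inf inf_le_left (inf_le_right.trans le_sup_left))
      (le_inf inf_le_left (inf_le_right.trans le_sup_right))
  have huy : u ⊓ y = x ⊓ y := by
    rw [hu, inf_assoc, inf_eq_right.2 (le_sup_left : y ≤ y ⊔ z)]
  have huz : u ⊓ z = x ⊓ z := by
    rw [hu, inf_assoc, inf_eq_right.2 (le_sup_right : z ≤ y ⊔ z)]
  have hub : u ⊓ b = s := by
    rw [hb, inf_comm, sup_comm, sup_inf_assoc_of_le _ (le_sup_right.trans hsu), inf_comm y, huy,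
      sup_comm]
  have huc : u ⊓ c = s := by
    rw [hc, inf_comm, sup_comm, sup_inf_assoc_of_le _ (le_sup_left.trans hsu), inf_comm z, huz]
  have hubc : u ≤ b ⊔ c :=
    inf_le_right.trans (sup_le_sup le_sup_left le_sup_left)
  have hnb : ¬ u ≤ b := fun hle => h (by rw [← hub, inf_eq_left.2 hle])
  have hnc : ¬ u ≤ c := fun hle => h (by rw [← huc, inf_eq_left.2 hle])
  have hsb : s ≤ b := hub ▸ inf_le_right
  have hsc : s ≤ c := huc ▸ inf_le_right
  -- `b ⊓ c` may lie strictly above `s`. Enlarging `u` to `u ⊔ b ⊓ c` makes all three pairwise meets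
  -- agree, by the modular law.
  have key : ∀ d : L, u ⊓ d = s → b ⊓ c ≤ d → (u ⊔ b ⊓ c) ⊓ d = b ⊓ c := by
    intro d hd hle
    rw [sup_comm, sup_inf_assoc_of_le _ hle, hd, sup_eq_left]
    exact le_inf hsb hsc
  refine ⟨b ⊓ c, u ⊔ b ⊓ c, b, c, ?_, ?_, ?_, key b hub inf_le_left, key c huc inf_le_right, rfl⟩
  · exact right_lt_sup.2 fun hle => hnb (hle.trans inf_le_left)
  · refine inf_lt_left.2 fun hle => hnc ?_
    rwa [sup_eq_right.2 hle] at hubc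
  · refine inf_lt_right.2 fun hle => hnb ?_
    rwa [sup_eq_left.2 hle] at hubc

/-- Covers of `m` chosen below elements with pairwise meet `m` cannot coincide: a common one would
lie below `m`. -/
theorem exists_three_upperCovers [Finite L] {x y z : L}
    (h : x ⊓ (y ⊔ z) ≠ (x ⊓ y) ⊔ (x ⊓ z)) :
    ∃ m a b c : L, m ⋖ a ∧ m ⋖ b ∧ m ⋖ c ∧ a ≠ b ∧ a ≠ c ∧ b ≠ c := by
  obtain ⟨m, a, b, c, ha, hb, hc, hab, hac, hbc⟩ := exists_three_of_not_distrib h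
  obtain ⟨a', ha, haa⟩ := exists_covBy_le_of_lt ha
  obtain ⟨b', hb, hbb⟩ := exists_covBy_le_of_lt hb
  obtain ⟨c', hc, hcc⟩ := exists_covBy_le_of_lt hc
  refine ⟨m, a', b', c', ha, hb, hc, ?_, ?_, ?_⟩ <;> rintro rfl
  · exact ha.lt.not_ge (hab ▸ le_inf haa hbb)
  · exact ha.lt.not_ge (hac ▸ le_inf haa hcc)
  · exact hb.lt.not_ge (hbc ▸ le_inf hbb hcc)

theorem CovBy.sup_of_covBy_of_ne {o x y : L} (hx : o ⋖ x) (hy : o ⋖ y) (h : x ≠ y) :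
    x ⋖ x ⊔ y := by
  have hxy : x ⊓ y = o := by
    rcases hx.eq_or_eq (le_inf hx.le hy.le) inf_le_left with h1 | h1
    · exact h1
    · rcases hy.eq_or_eq hx.le (inf_eq_left.1 h1) with h2 | h2
      · exact absurd h2 hx.ne'
      · exact absurd h2 h
  refine covBy_sup_of_inf_covBy_right ?_
  rwa [hxy]

end Modular

/-! ### Planar diagrams: the curve of a maximal chain and its two sides. -/

section Planar

variable {L : Type*} [Lattice L] {p : L → ℝ × ℝ} {C : Flag L}

/-- The polygonal curve drawn by a maximal chain. -/
def flagCurve (p : L → ℝ × ℝ) (C : Flag L) : Set (ℝ × ℝ) :=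
  {q | ∃ a ∈ C, ∃ b ∈ C, a ⋖ b ∧ q ∈ segment ℝ (p a) (p b)}

/-- The point `q` is strictly to the left of the curve of `C`. -/
def IsLeftOf (p : L → ℝ × ℝ) (C : Flag L) (q : ℝ × ℝ) : Prop :=
  ∃ k ∈ flagCurve p C, k.2 = q.2 ∧ q.1 < k.1

/-- The point `q` is strictly to the right of the curve of `C`. -/
def IsRightOf (p : L → ℝ × ℝ) (C : Flag L) (q : ℝ × ℝ) : Prop :=
  ∃ k ∈ flagCurve p C, k.2 = q.2 ∧ k.1 < q.1

theorem snd_mem_of_mem_segment {u v q : ℝ × ℝ} (huv : u.2 ≤ v.2) (hq : q ∈ segment ℝ u v) :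
    u.2 ≤ q.2 ∧ q.2 ≤ v.2 := by
  obtain ⟨a, b, ha, hb, hab, rfl⟩ := hq
  obtain rfl : a = 1 - b := by linarith
  simp only [Prod.snd_add, Prod.smul_snd, smul_eq_mul]
  constructor <;> nlinarith

theorem eq_of_mem_segment_of_snd_eq {u v q r : ℝ × ℝ} (huv : u.2 < v.2)
    (hq : q ∈ segment ℝ u v) (hr : r ∈ segment ℝ u v) (h : q.2 = r.2) : q = r := by
  obtain ⟨a, b, ha, hb, hab, rfl⟩ := hq
  obtain ⟨c, d, hc, hd, hcd, rfl⟩ := hr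
  obtain rfl : a = 1 - b := by linarith
  obtain rfl : c = 1 - d := by linarith
  simp only [Prod.snd_add, Prod.smul_snd, smul_eq_mul] at h
  have : b = d := by
    have h1 : (b - d) * (v.2 - u.2) = 0 := by linarith
    rcases mul_eq_zero.1 h1 with h2 | h2 <;> linarith
  rw [this]

theorem exists_mem_segment_snd_eq {u v : ℝ × ℝ} {t : ℝ} (hut : u.2 ≤ t) (htv : t ≤ v.2)
    (huv : u.2 < v.2) : ∃ q ∈ segment ℝ u v, q.2 = t := by
  have hpos : 0 < v.2 - u.2 := by linarith
  refine ⟨_, ⟨1 - (t - u.2) / (v.2 - u.2), (t - u.2) / (v.2 - u.2), ?_, ?_, by ring, rfl⟩, ?_⟩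
  · rw [sub_nonneg, div_le_one hpos]; linarith
  · exact div_nonneg (by linarith) hpos.le
  · simp only [Prod.snd_add, Prod.smul_snd, smul_eq_mul]
    field_simp
    ring

theorem isCompact_segment (u v : ℝ × ℝ) : IsCompact (segment ℝ u v) := by
  rw [← convexHull_pair]
  exact (Set.toFinite _).isCompact_convexHull ℝ

theorem isCompact_flagCurve [Finite L] : IsCompact (flagCurve p C) := by
  have : flagCurve p C = ⋃ e ∈ {e : L × L | e.1 ∈ C ∧ e.2 ∈ C ∧ e.1 ⋖ e.2},
      segment ℝ (p e.1) (p e.2) := by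
    ext q
    simp only [flagCurve, Set.mem_ofPred_eq, Set.mem_iUnion, Prod.exists, exists_prop]
    constructor
    · rintro ⟨a, ha, b, hb, hab, hq⟩
      exact ⟨a, b, ⟨ha, hb, hab⟩, hq⟩
    · rintro ⟨a, b, ⟨ha, hb, hab⟩, hq⟩
      exact ⟨a, ha, b, hb, hab, hq⟩
  rw [this]
  exact (Set.toFinite _).isCompact_biUnion fun e _ => isCompact_segment _ _

/-- The set is the Minkowski sum of the compact curve and a closed horizontal ray. -/
theorem isClosed_weaklyLeft [Finite L] :
    IsClosed {q : ℝ × ℝ | ∃ k ∈ flagCurve p C, k.2 = q.2 ∧ q.1 ≤ k.1} := by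
  have : {q : ℝ × ℝ | ∃ k ∈ flagCurve p C, k.2 = q.2 ∧ q.1 ≤ k.1} =
      flagCurve p C + Set.Iic (0 : ℝ) ×ˢ {(0 : ℝ)} := by
    ext q
    simp only [Set.mem_ofPred_eq, Set.mem_add, Set.mem_prod, Set.mem_Iic, Set.mem_singleton_iff]
    constructor
    · rintro ⟨k, hk, h2, h1⟩
      exact ⟨k, hk, (q.1 - k.1, 0), ⟨by simpa using h1, rfl⟩, by ext <;> simp [h2]⟩
    · rintro ⟨k, hk, r, ⟨h1, h2⟩, rfl⟩
      exact ⟨k, hk, by simp [h2], by simpa using h1⟩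
  rw [this]
  exact (isClosed_Iic.prod isClosed_singleton).add_left_of_isCompact isCompact_flagCurve

theorem isClosed_weaklyRight [Finite L] :
    IsClosed {q : ℝ × ℝ | ∃ k ∈ flagCurve p C, k.2 = q.2 ∧ k.1 ≤ q.1} := by
  have : {q : ℝ × ℝ | ∃ k ∈ flagCurve p C, k.2 = q.2 ∧ k.1 ≤ q.1} =
      flagCurve p C + Set.Ici (0 : ℝ) ×ˢ {(0 : ℝ)} := by
    ext q
    simp only [Set.mem_ofPred_eq, Set.mem_add, Set.mem_prod, Set.mem_Ici, Set.mem_singleton_iff]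
    constructor
    · rintro ⟨k, hk, h2, h1⟩
      exact ⟨k, hk, (q.1 - k.1, 0), ⟨by simpa using h1, rfl⟩, by ext <;> simp [h2]⟩
    · rintro ⟨k, hk, r, ⟨h1, h2⟩, rfl⟩
      exact ⟨k, hk, by simp [h2], by simpa using h1⟩
  rw [this]
  exact (isClosed_Ici.prod isClosed_singleton).add_left_of_isCompact isCompact_flagCurve

theorem exists_covBy_mem_flag [Finite L] {a t : L} (ha : a ∈ C) (ht : t ∈ C) (hat : a < t) :
    ∃ b ∈ C, a ⋖ b := by
  have : (⟨a, ha⟩ : C) < ⟨t, ht⟩ := hat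
  obtain ⟨b, hb, -⟩ := exists_covBy_le_of_lt this
  exact ⟨b, b.2, Flag.coe_covBy_coe.2 hb⟩

variable (hp : IsPlanarDiagram p)
include hp

theorem IsPlanarDiagram.strictMono_snd [Finite L] : StrictMono fun a => (p a).2 := by
  classical
  have := Fintype.ofFinite L
  let : DecidableLE L := Classical.decRel _
  let : LocallyFiniteOrder L := Fintype.toLocallyFiniteOrder
  exact (strictMono_iff_forall_covBy _).2 fun a b h => hp.upward a b h

/-- Two edges of a chain coincide or one starts no lower than the other ends. So the curve is a
graph over the height, and left and right exclude each other. -/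
theorem eq_of_mem_flagCurve_of_snd_eq [Finite L] {q r : ℝ × ℝ} (hq : q ∈ flagCurve p C)
    (hr : r ∈ flagCurve p C) (h : q.2 = r.2) : q = r := by
  have above : ∀ {a b c d : L} {q r : ℝ × ℝ}, b ∈ C → c ∈ C → a ⋖ b → c ⋖ d → a < c →
      q ∈ segment ℝ (p a) (p b) → r ∈ segment ℝ (p c) (p d) → q.2 = r.2 → q = r := by
    intro a b c d q r hb hc hab hcd hac hq hr h
    have hbc : b ≤ c := by
      rcases C.le_or_le hb hc with h1 | h1
      · exact h1
      · rcases hab.eq_or_eq hac.le h1 with h2 | h2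
        · exact absurd h2 hac.ne'
        · exact h2.ge
    have h1 := (snd_mem_of_mem_segment (hp.upward a b hab).le hq).2
    have h2 := (snd_mem_of_mem_segment (hp.upward c d hcd).le hr).1
    obtain rfl : b = c := by
      by_contra hne
      have := hp.strictMono_snd (lt_of_le_of_ne hbc hne)
      simp only at this
      linarith
    rw [eq_of_mem_segment_of_snd_eq (hp.upward a b hab) hq (right_mem_segment _ _ _) (by linarith),
      eq_of_mem_segment_of_snd_eq (hp.upward b d hcd) hr (left_mem_segment _ _ _) (by linarith)]
  obtain ⟨a, ha, b, hb, hab, hqs⟩ := hq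
  obtain ⟨c, hc, d, hd, hcd, hrs⟩ := hr
  rcases (C.le_or_le ha hc) with hac | hac
  · rcases hac.eq_or_lt with rfl | hac
    · obtain rfl : b = d := by
        rcases C.le_or_le hb hd with h1 | h1
        · exact (hcd.eq_or_eq hab.le h1).resolve_left hab.ne'
        · exact ((hab.eq_or_eq hcd.le h1).resolve_left hcd.ne').symm
      exact eq_of_mem_segment_of_snd_eq (hp.upward a b hab) hqs hrs h
    · exact above hb hc hab hcd hac hqs hrs h
  · rcases hac.eq_or_lt with rfl | hac
    · obtain rfl : b = d := by
        rcases C.le_or_le hb hd with h1 | h1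
        · exact (hcd.eq_or_eq hab.le h1).resolve_left hab.ne'
        · exact ((hab.eq_or_eq hcd.le h1).resolve_left hcd.ne').symm
      exact eq_of_mem_segment_of_snd_eq (hp.upward c b hab) hqs hrs h
    · exact (above hd ha hcd hab hac hrs hqs h.symm).symm

theorem IsLeftOf.not_isRightOf [Finite L] {q : ℝ × ℝ} (hl : IsLeftOf p C q) :
    ¬ IsRightOf p C q := by
  rintro ⟨k, hk, h2, h1⟩
  obtain ⟨k', hk', h2', h1'⟩ := hl
  have := eq_of_mem_flagCurve_of_snd_eq hp hk hk' (h2.trans h2'.symm)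
  subst this
  exact lt_asymm h1 h1'

theorem exists_mem_flagCurve_snd_eq [Finite L] [BoundedOrder L] [Nontrivial L] {t : ℝ}
    (h0 : (p ⊥).2 ≤ t) (h1 : t ≤ (p ⊤).2) : ∃ k ∈ flagCurve p C, k.2 = t := by
  -- Requiring `a < ⊤` leaves an edge of the chain above `a` even when `t` is the height of `⊤`.
  obtain ⟨a, ⟨haC, hat, hatop⟩, hmax⟩ :=
    (Set.toFinite {a | a ∈ C ∧ (p a).2 ≤ t ∧ a < ⊤}).exists_maximal
      ⟨⊥, C.bot_mem, h0, bot_lt_top⟩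
  obtain ⟨b, hbC, hab⟩ := exists_covBy_mem_flag haC C.top_mem hatop
  have htb : t ≤ (p b).2 := by
    by_contra! hlt
    have hb : b < ⊤ := lt_top_iff_ne_top.2 fun h => by subst h; linarith
    exact hab.lt.not_ge (hmax ⟨hbC, hlt.le, hb⟩ hab.le)
  obtain ⟨k, hk, hkt⟩ := exists_mem_segment_snd_eq hat htb (hp.upward a b hab)
  exact ⟨k, ⟨a, haC, b, hbC, hab, hk⟩, hkt⟩

theorem snd_mem_of_mem_edge [Finite L] [BoundedOrder L] {a b : L} {q : ℝ × ℝ} (hab : a ⋖ b)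
    (hq : q ∈ segment ℝ (p a) (p b)) : (p ⊥).2 ≤ q.2 ∧ q.2 ≤ (p ⊤).2 := by
  have h := snd_mem_of_mem_segment (hp.upward a b hab).le hq
  have h0 := hp.strictMono_snd.monotone (bot_le : ⊥ ≤ a)
  have h1 := hp.strictMono_snd.monotone (le_top : b ≤ ⊤)
  exact ⟨h0.trans h.1, h.2.trans h1⟩

/-- A point of an edge which is off the curve of a maximal chain lies on exactly one side. -/
theorem isLeftOf_or_isRightOf [Finite L] [BoundedOrder L] [Nontrivial L] {a b : L} {q : ℝ × ℝ}
    (hab : a ⋖ b) (hq : q ∈ segment ℝ (p a) (p b)) (hqC : q ∉ flagCurve p C) :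
    IsLeftOf p C q ∨ IsRightOf p C q := by
  have hb := snd_mem_of_mem_edge hp hab hq
  obtain ⟨k, hk, hkq⟩ := exists_mem_flagCurve_snd_eq hp (C := C) hb.1 hb.2
  rcases lt_trichotomy q.1 k.1 with h | h | h
  · exact Or.inl ⟨k, hk, hkq, h⟩
  · exact absurd (Prod.ext h hkq.symm ▸ hk) hqC
  · exact Or.inr ⟨k, hk, hkq, h⟩

/-- The closed weakly left and weakly right sets cover `S`, so by connectedness they meet within it;
a common point lies on the curve. -/
theorem not_separated_of_isPreconnected [Finite L] [BoundedOrder L] [Nontrivial L] {a b : L}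
    (hab : a ⋖ b) {S : Set (ℝ × ℝ)} (hS : IsPreconnected S)
    (hsub : S ⊆ segment ℝ (p a) (p b)) (hdisj : ∀ q ∈ S, q ∉ flagCurve p C)
    {u v : ℝ × ℝ} (hu : u ∈ S) (hv : v ∈ S) (hul : IsLeftOf p C u) (hvr : IsRightOf p C v) :
    False := by
  obtain ⟨q, hqS, ⟨k, hk, h2, h1⟩, ⟨k', hk', h2', h1'⟩⟩ :=
    isPreconnected_closed_iff.1 hS _ _ isClosed_weaklyLeft isClosed_weaklyRight
    (fun q hq => (isLeftOf_or_isRightOf hp hab (hsub hq) (hdisj q hq)).imp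
      (fun ⟨k, hk, h2, h1⟩ => ⟨k, hk, h2, h1.le⟩) (fun ⟨k, hk, h2, h1⟩ => ⟨k, hk, h2, h1.le⟩))
    (let ⟨k, hk, h2, h1⟩ := hul; ⟨u, hu, k, hk, h2, h1.le⟩)
    (let ⟨k, hk, h2, h1⟩ := hvr; ⟨v, hv, k, hk, h2, h1.le⟩)
  have := eq_of_mem_flagCurve_of_snd_eq hp hk hk' (h2.trans h2'.symm)
  subst this
  exact hdisj q hqS (Prod.ext (le_antisymm h1 h1') h2.symm ▸ hk)

/-- An edge that does not belong to a maximal chain meets its curve only in ends on the chain. -/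
theorem mem_image_of_mem_flagCurve {c d : L} (hcd : c ⋖ d) (hC : ¬ (c ∈ C ∧ d ∈ C)) {q : ℝ × ℝ}
    (hq : q ∈ segment ℝ (p c) (p d)) (hqC : q ∈ flagCurve p C) :
    (c ∈ C ∧ q = p c) ∨ (d ∈ C ∧ q = p d) := by
  obtain ⟨a, ha, b, hb, hab, hqs⟩ := hqC
  obtain ⟨e, ⟨he, he'⟩, rfl⟩ := hp.noncrossing c d a b hcd hab
    (by rintro ⟨⟩; exact hC ⟨ha, hb⟩) ⟨hq, hqs⟩
  have heC : e ∈ C := by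
    rcases he' with rfl | rfl
    · exact ha
    · exact hb
  rcases he with rfl | rfl
  · exact Or.inl ⟨heC, rfl⟩
  · exact Or.inr ⟨heC, rfl⟩

/-- As `v` is off the chain, at most one end of the edge is on it. Deleting that end leaves a convex
set that avoids the curve. -/
theorem exists_isPreconnected_edge {c d v : L} (hcd : c ⋖ d) (hv : v = c ∨ v = d) (hvC : v ∉ C)
    {q : ℝ × ℝ} (hq : q ∈ segment ℝ (p c) (p d)) (hqv : c ∈ C → q ≠ p c)
    (hqv' : d ∈ C → q ≠ p d) :
    ∃ S, IsPreconnected S ∧ S ⊆ segment ℝ (p c) (p d) ∧ (∀ r ∈ S, r ∉ flagCurve p C) ∧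
      q ∈ S ∧ p v ∈ S := by
  have hlt := hp.upward c d hcd
  have hb := snd_mem_of_mem_segment hlt.le hq
  have hC : ¬ (c ∈ C ∧ d ∈ C) := fun h => hvC (by rcases hv with rfl | rfl; exacts [h.1, h.2])
  have hup : Convex ℝ {r : ℝ × ℝ | (p c).2 < r.2} :=
    convex_halfSpace_gt (LinearMap.snd ℝ ℝ ℝ).isLinear _
  have hdown : Convex ℝ {r : ℝ × ℝ | r.2 < (p d).2} :=
    convex_halfSpace_lt (LinearMap.snd ℝ ℝ ℝ).isLinear _
  by_cases hc : c ∈ C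
  · have hvd : v = d := hv.resolve_left fun h => hvC (h ▸ hc)
    subst hvd
    refine ⟨segment ℝ (p c) (p v) ∩ {r | (p c).2 < r.2},
      ((convex_segment _ _).inter hup).isPreconnected, Set.inter_subset_left, ?_, ⟨hq, ?_⟩,
      right_mem_segment _ _ _, hlt⟩
    · rintro r ⟨hr, hr2⟩ hrC
      rcases mem_image_of_mem_flagCurve hp hcd hC hr hrC with ⟨-, rfl⟩ | ⟨h, -⟩
      · exact absurd hr2 (by simp)
      · exact hvC h
    · refine lt_of_le_of_ne hb.1 fun h => hqv hc ?_
      exact eq_of_mem_segment_of_snd_eq hlt hq (left_mem_segment _ _ _) h.symm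
  by_cases hd : d ∈ C
  · have hvc : v = c := hv.resolve_right fun h => hvC (h ▸ hd)
    subst hvc
    refine ⟨segment ℝ (p v) (p d) ∩ {r | r.2 < (p d).2},
      ((convex_segment _ _).inter hdown).isPreconnected, Set.inter_subset_left, ?_, ⟨hq, ?_⟩,
      left_mem_segment _ _ _, hlt⟩
    · rintro r ⟨hr, hr2⟩ hrC
      rcases mem_image_of_mem_flagCurve hp hcd hC hr hrC with ⟨h, -⟩ | ⟨-, rfl⟩
      · exact hvC h
      · exact absurd hr2 (by simp)
    · refine lt_of_le_of_ne hb.2 fun h => hqv' hd ?_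
      exact eq_of_mem_segment_of_snd_eq hlt hq (right_mem_segment _ _ _) h
  · refine ⟨segment ℝ (p c) (p d), (convex_segment _ _).isPreconnected, subset_rfl, ?_, hq, ?_⟩
    · intro r hr hrC
      rcases mem_image_of_mem_flagCurve hp hcd hC hr hrC with ⟨h, -⟩ | ⟨h, -⟩
      · exact hc h
      · exact hd h
    · rcases hv with rfl | rfl
      · exact left_mem_segment _ _ _
      · exact right_mem_segment _ _ _

theorem sides_of_mem_edge [Finite L] [BoundedOrder L] [Nontrivial L] {c d v : L}
    (hcd : c ⋖ d) (hv : v = c ∨ v = d) (hvC : v ∉ C)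
    {q : ℝ × ℝ} (hq : q ∈ segment ℝ (p c) (p d)) (hqv : c ∈ C → q ≠ p c)
    (hqv' : d ∈ C → q ≠ p d) :
    (IsLeftOf p C q → IsLeftOf p C (p v)) ∧ (IsRightOf p C q → IsRightOf p C (p v)) := by
  obtain ⟨S, hS, hsub, hdisj, hqS, hvS⟩ :=
    exists_isPreconnected_edge hp hcd hv hvC hq hqv hqv'
  have hside := isLeftOf_or_isRightOf hp hcd (hsub hvS) (hdisj _ hvS)
  exact ⟨fun hl => hside.resolve_right fun hr =>
      not_separated_of_isPreconnected hp hcd hS hsub hdisj hqS hvS hl hr,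
    fun hr => hside.resolve_left fun hl =>
      not_separated_of_isPreconnected hp hcd hS hsub hdisj hvS hqS hl hr⟩

theorem sides_of_edge [Finite L] [BoundedOrder L] [Nontrivial L] {a b : L} (hab : a ⋖ b)
    (ha : a ∉ C) (hb : b ∉ C) :
    (IsLeftOf p C (p a) ↔ IsLeftOf p C (p b)) ∧ (IsRightOf p C (p a) ↔ IsRightOf p C (p b)) := by
  have h1 := sides_of_mem_edge hp hab (Or.inr rfl) hb (left_mem_segment _ _ _)
    (fun h => absurd h ha) (fun h => absurd h hb)
  have h2 := sides_of_mem_edge hp hab (Or.inl rfl) ha (right_mem_segment _ _ _)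
    (fun h => absurd h ha) (fun h => absurd h hb)
  exact ⟨⟨h1.1, h2.1⟩, ⟨h1.2, h2.2⟩⟩

/-! ### Sides of covers and maximal chains that separate them. -/

omit hp in
theorem notMem_flag_of_upperCovers {o x y : L} (hx : o ⋖ x) (hy : o ⋖ y) (hne : x ≠ y)
    (hyC : y ∈ C) : x ∉ C := by
  intro hxC
  rcases C.le_or_le hxC hyC with h | h
  · exact (hy.eq_or_eq hx.le h).elim hx.ne' hne
  · exact (hx.eq_or_eq hy.le h).elim hy.ne' hne.symm

omit hp in
theorem notMem_flag_of_lowerCovers {i x y : L} (hx : x ⋖ i) (hy : y ⋖ i) (hne : x ≠ y)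
    (hyC : y ∈ C) : x ∉ C := by
  intro hxC
  rcases C.le_or_le hxC hyC with h | h
  · exact (hx.eq_or_eq h hy.le).elim hne.symm hy.ne
  · exact (hy.eq_or_eq h hx.le).elim hne hx.ne

/-- The side of an upper cover `x` of `o` with respect to a maximal chain through `o` and `y`
is read off from the edges just above `o`. -/
theorem side_of_upperCover [Finite L] [BoundedOrder L] [Nontrivial L] {o x y : L}
    (hx : o ⋖ x) (hy : o ⋖ y) (hne : x ≠ y) (hoC : o ∈ C) (hyC : y ∈ C) {q k : ℝ × ℝ}
    (hq : q ∈ segment ℝ (p o) (p x)) (hk : k ∈ segment ℝ (p o) (p y)) (hqk : q.2 = k.2)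
    (hoq : (p o).2 < q.2) :
    (q.1 < k.1 ∧ IsLeftOf p C (p x)) ∨ (k.1 < q.1 ∧ IsRightOf p C (p x)) := by
  have hxC := notMem_flag_of_upperCovers hx hy hne hyC
  have hkC : k ∈ flagCurve p C := ⟨o, hoC, y, hyC, hy, hk⟩
  have hqo : q ≠ p o := fun h => by rw [h] at hoq; exact lt_irrefl _ hoq
  have hqC : q ∉ flagCurve p C := fun h =>
    (mem_image_of_mem_flagCurve hp hx (fun h => hxC h.2) hq h).elim (fun h => hqo h.2)
      (fun h => hxC h.1)
  have hsides := sides_of_mem_edge hp hx (Or.inr rfl) hxC hq (fun _ => hqo)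
    (fun h => absurd h hxC)
  rcases lt_trichotomy q.1 k.1 with h | h | h
  · exact Or.inl ⟨h, hsides.1 ⟨k, hkC, hqk.symm, h⟩⟩
  · exact absurd (Prod.ext h hqk ▸ hkC) hqC
  · exact Or.inr ⟨h, hsides.2 ⟨k, hkC, hqk.symm, h⟩⟩

theorem side_of_lowerCover [Finite L] [BoundedOrder L] [Nontrivial L] {i x y : L}
    (hx : x ⋖ i) (hy : y ⋖ i) (hne : x ≠ y) (hiC : i ∈ C) (hyC : y ∈ C) {q k : ℝ × ℝ}
    (hq : q ∈ segment ℝ (p x) (p i)) (hk : k ∈ segment ℝ (p y) (p i)) (hqk : q.2 = k.2)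
    (hqi : q.2 < (p i).2) :
    (q.1 < k.1 ∧ IsLeftOf p C (p x)) ∨ (k.1 < q.1 ∧ IsRightOf p C (p x)) := by
  have hxC := notMem_flag_of_lowerCovers hx hy hne hyC
  have hkC : k ∈ flagCurve p C := ⟨y, hyC, i, hiC, hy, hk⟩
  have hqi : q ≠ p i := fun h => by rw [h] at hqi; exact lt_irrefl _ hqi
  have hqC : q ∉ flagCurve p C := fun h =>
    (mem_image_of_mem_flagCurve hp hx (fun h => hxC h.1) hq h).elim (fun h => hxC h.1)
      (fun h => hqi h.2)
  have hsides := sides_of_mem_edge hp hx (Or.inl rfl) hxC hq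
    (fun h => absurd h hxC) (fun _ => hqi)
  rcases lt_trichotomy q.1 k.1 with h | h | h
  · exact Or.inl ⟨h, hsides.1 ⟨k, hkC, hqk.symm, h⟩⟩
  · exact absurd (Prod.ext h hqk ▸ hkC) hqC
  · exact Or.inr ⟨h, hsides.2 ⟨k, hkC, hqk.symm, h⟩⟩

/-- The side of a lower cover `x` of `i` is the same for all maximal chains through another lower
cover `y` of `i` and `i`. -/
theorem sides_of_lowerCover_congr [Finite L] [BoundedOrder L] [Nontrivial L] {D : Flag L}
    {i x y : L} (hx : x ⋖ i) (hy : y ⋖ i) (hne : x ≠ y) (hiC : i ∈ C) (hyC : y ∈ C)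
    (hiD : i ∈ D) (hyD : y ∈ D) :
    (IsLeftOf p C (p x) → IsLeftOf p D (p x)) ∧ (IsRightOf p C (p x) → IsRightOf p D (p x)) := by
  have hxi := hp.upward x i hx
  have hyi := hp.upward y i hy
  have ht : max (p x).2 (p y).2 < (p i).2 := max_lt hxi hyi
  -- The horizontal order of the two edges at this height does not involve the chain, so it fixes
  -- the same side for `C` and `D`.
  obtain ⟨q, hq, hqt⟩ := exists_mem_segment_snd_eq (le_max_left (p x).2 (p y).2) ht.le hxi
  obtain ⟨k, hk, hkt⟩ := exists_mem_segment_snd_eq (le_max_right (p x).2 (p y).2) ht.le hyi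
  have hqk := hqt.trans hkt.symm
  have h1 := side_of_lowerCover hp hx hy hne hiC hyC hq hk hqk (hqt ▸ ht)
  have h2 := side_of_lowerCover hp hx hy hne hiD hyD hq hk hqk (hqt ▸ ht)
  rcases h1 with ⟨h1, hC⟩ | ⟨h1, hC⟩
  · have hD := h2.resolve_right fun h => lt_asymm h.1 h1
    exact ⟨fun _ => hD.2, fun h => absurd h (hC.not_isRightOf hp)⟩
  · have hD := h2.resolve_left fun h => lt_asymm h.1 h1
    exact ⟨fun h => absurd hC (h.not_isRightOf hp), fun _ => hD.2⟩

/-- A maximal chain that separates `x` from `z` passes through every common upper cover. -/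
theorem mem_flag_of_separated_lowerCovers [Finite L] [BoundedOrder L] [Nontrivial L] {x z i : L}
    (hxi : x ⋖ i) (hzi : z ⋖ i) (hx : x ∉ C) (hz : z ∉ C)
    (hl : IsLeftOf p C (p x)) (hr : IsRightOf p C (p z)) : i ∈ C := by
  by_contra hi
  exact ((sides_of_edge hp hxi hx hi).1.1 hl).not_isRightOf hp
    ((sides_of_edge hp hzi hz hi).2.1 hr)

/-- A maximal chain that separates `x` from `z` passes through every common lower cover. -/
theorem mem_flag_of_separated_upperCovers [Finite L] [BoundedOrder L] [Nontrivial L] {x z o : L}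
    (hox : o ⋖ x) (hoz : o ⋖ z) (hx : x ∉ C) (hz : z ∉ C)
    (hl : IsLeftOf p C (p x)) (hr : IsRightOf p C (p z)) : o ∈ C := by
  by_contra ho
  exact ((sides_of_edge hp hox ho hx).1.2 hl).not_isRightOf hp
    ((sides_of_edge hp hoz ho hz).2.2 hr)

omit hp in
theorem exists_flag_of_le_of_le {a b c : L} (hab : a ≤ b) (hbc : b ≤ c) :
    ∃ C : Flag L, a ∈ C ∧ b ∈ C ∧ c ∈ C := by
  have hchain : IsChain (· ≤ ·) ({a, b, c} : Set L) := by
    refine (IsChain.pair hbc).insert ?_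
    rintro d (rfl | rfl) -
    · exact Or.inl hab
    · exact Or.inl (hab.trans hbc)
  obtain ⟨C, hC⟩ := hchain.exists_subset_flag
  exact ⟨C, hC (by simp), hC (by simp), hC (by simp)⟩

/-! ### The middle one of three covers. -/

theorem sup_eq_and_isDoublyIrreducible_of_between [Finite L] [BoundedOrder L] [Nontrivial L]
    [IsModularLattice L] {o x y z : L} (hx : o ⋖ x) (hy : o ⋖ y) (hz : o ⋖ z) (hxy : x ≠ y)
    (hxz : x ≠ z) (hyz : y ≠ z)
    (hsep : ∀ C : Flag L, o ∈ C → y ∈ C → IsLeftOf p C (p x) ∧ IsRightOf p C (p z)) :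
    x ⊔ y = x ⊔ z ∧ y ⊔ z = x ⊔ z ∧ IsDoublyIrreducible y := by
  have hxi : x ⋖ x ⊔ z := CovBy.sup_of_covBy_of_ne hx hz hxz
  have hzi : z ⋖ x ⊔ z := sup_comm z x ▸ CovBy.sup_of_covBy_of_ne hz hx hxz.symm
  set i := x ⊔ z
  have hmem : ∀ C : Flag L, o ∈ C → y ∈ C → i ∈ C := fun C ho hyC =>
    mem_flag_of_separated_lowerCovers hp hxi hzi (notMem_flag_of_upperCovers hx hy hxy hyC)
      (notMem_flag_of_upperCovers hz hy hyz.symm hyC) (hsep C ho hyC).1 (hsep C ho hyC).2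
  have hiy : ¬ i ≤ y := fun h =>
    (hy.eq_or_eq hx.le (hxi.le.trans h)).elim hx.ne' hxy
  have hyi : y ≤ i := by
    obtain ⟨C, ho, hyC, -⟩ := exists_flag_of_le_of_le hy.le (le_refl y)
    exact (C.le_or_le hyC (hmem C ho hyC)).resolve_right hiy
  have hxyi : x ⊔ y = i :=
    (hxi.eq_or_eq le_sup_left (sup_le hxi.le hyi)).resolve_left
      (CovBy.sup_of_covBy_of_ne hx hy hxy).ne'
  have hyzi : y ⊔ z = i :=
    (hzi.eq_or_eq le_sup_right (sup_le hyi hzi.le)).resolve_left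
      (sup_comm z y ▸ CovBy.sup_of_covBy_of_ne hz hy hyz.symm).ne'
  have hycov : y ⋖ i := by
    rw [← hyzi]
    exact CovBy.sup_of_covBy_of_ne hy hz hyz
  refine ⟨hxyi, hyzi, ?_, ?_⟩
  · refine Set.ncard_eq_one.2 ⟨i, Set.eq_singleton_iff_unique_mem.2 ⟨hycov, fun w hw => ?_⟩⟩
    replace hw : y ⋖ w := hw
    obtain ⟨C, ho, hyC, hwC⟩ := exists_flag_of_le_of_le hy.le hw.le
    by_contra hne
    exact notMem_flag_of_upperCovers hw hycov hne (hmem C ho hyC) hwC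
  · refine Set.ncard_eq_one.2 ⟨o, Set.eq_singleton_iff_unique_mem.2 ⟨hy, fun u hu => ?_⟩⟩
    replace hu : u ⋖ y := hu
    obtain ⟨C, hoC, hyC, hiC⟩ := exists_flag_of_le_of_le hy.le hyi
    -- `D` is not known to contain `o`, so `hsep` does not apply to it. Since `C` and `D` share the
    -- edge from `y` to `i`, the separation is transferred at `i`.
    obtain ⟨D, huD, hyD, hiD⟩ := exists_flag_of_le_of_le hu.le hyi
    have hoD : o ∈ D := mem_flag_of_separated_upperCovers hp hx hz
      (notMem_flag_of_lowerCovers hxi hycov hxy hyD)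
      (notMem_flag_of_lowerCovers hzi hycov hyz.symm hyD)
      ((sides_of_lowerCover_congr hp hxi hycov hxy hiC hyC hiD hyD).1 (hsep C hoC hyC).1)
      ((sides_of_lowerCover_congr hp hzi hycov hyz.symm hiC hyC hiD hyD).2 (hsep C hoC hyC).2)
    by_contra hne
    exact notMem_flag_of_lowerCovers hu hy hne hoD huD

omit hp in
theorem sup_eq_and_exists_isDoublyIrreducible [Finite L] [IsModularLattice L]
    (hL : IsPlanar L) {o x y z : L} (hx : o ⋖ x) (hy : o ⋖ y) (hz : o ⋖ z) (hxy : x ≠ y)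
    (hxz : x ≠ z) (hyz : y ≠ z) :
    x ⊔ y = x ⊔ z ∧ y ⊔ z = x ⊔ z ∧ ∃ w, o ⋖ w ∧ IsDoublyIrreducible w := by
  obtain ⟨p, hp⟩ := hL
  have := Fintype.ofFinite L
  have : Nonempty L := ⟨o⟩
  let : BoundedOrder L := Fintype.toBoundedOrder L
  have : Nontrivial L := ⟨o, x, hx.ne⟩
  have hox := hp.upward o x hx
  have hoy := hp.upward o y hy
  have hoz := hp.upward o z hz
  -- A height above `o` that all three edges reach; their order there determines the middle cover.
  set t := min (p x).2 (min (p y).2 (p z).2)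
  have hot : (p o).2 < t := lt_min hox (lt_min hoy hoz)
  obtain ⟨a, ha, hat⟩ := exists_mem_segment_snd_eq hot.le (min_le_left _ _ : t ≤ (p x).2) hox
  obtain ⟨b, hb, hbt⟩ := exists_mem_segment_snd_eq hot.le
    ((min_le_right _ _).trans (min_le_left _ _) : t ≤ (p y).2) hoy
  obtain ⟨c, hc, hct⟩ := exists_mem_segment_snd_eq hot.le
    ((min_le_right _ _).trans (min_le_right _ _) : t ≤ (p z).2) hoz
  have hne : ∀ {u v : L} {q r : ℝ × ℝ}, o ⋖ u → o ⋖ v → u ≠ v → q ∈ segment ℝ (p o) (p u) →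
      r ∈ segment ℝ (p o) (p v) → q.2 = t → r.2 = t → q.1 ≠ r.1 := by
    intro u v q r hu hv huv hq hr hqt hrt h
    obtain ⟨C, hoC, hvC, -⟩ := exists_flag_of_le_of_le hv.le (le_refl v)
    rcases side_of_upperCover hp hu hv huv hoC hvC hq hr (hqt.trans hrt.symm) (hqt ▸ hot) with
      h1 | h1
    · exact h1.1.ne h
    · exact h1.1.ne' h
  have sorted : ∀ {u v w : L} {q r s : ℝ × ℝ}, o ⋖ u → o ⋖ v → o ⋖ w → u ≠ v → u ≠ w → v ≠ w →
      q ∈ segment ℝ (p o) (p u) → r ∈ segment ℝ (p o) (p v) → s ∈ segment ℝ (p o) (p w) →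
      q.2 = t → r.2 = t → s.2 = t → q.1 < r.1 → r.1 < s.1 →
      u ⊔ v = u ⊔ w ∧ v ⊔ w = u ⊔ w ∧ IsDoublyIrreducible v := by
    intro u v w q r s hu hv hw huv huw hvw hq hr hs hqt hrt hst hqr hrs
    refine sup_eq_and_isDoublyIrreducible_of_between hp hu hv hw huv huw hvw fun C hoC hvC => ?_
    have h1 := side_of_upperCover hp hu hv huv hoC hvC hq hr (hqt.trans hrt.symm) (hqt ▸ hot)
    have h2 := side_of_upperCover hp hw hv hvw.symm hoC hvC hs hr (hst.trans hrt.symm)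
      (hst ▸ hot)
    exact ⟨(h1.resolve_right fun h => lt_asymm h.1 hqr).2,
      (h2.resolve_left fun h => lt_asymm h.1 hrs).2⟩
  -- Of the eight sign patterns, six are orderings and two are cyclic, hence impossible.
  rcases (hne hx hy hxy ha hb hat hbt).lt_or_gt with hab | hab <;>
  rcases (hne hx hz hxz ha hc hat hct).lt_or_gt with hac | hac <;>
  rcases (hne hy hz hyz hb hc hbt hct).lt_or_gt with hbc | hbc
  · obtain ⟨h1, h2, h3⟩ := sorted hx hy hz hxy hxz hyz ha hb hc hat hbt hct hab hbc
    exact ⟨h1, h2, y, hy, h3⟩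
  · obtain ⟨h1, h2, h3⟩ := sorted hx hz hy hxz hxy hyz.symm ha hc hb hat hct hbt hac hbc
    exact ⟨h1.symm, by rw [sup_comm, h2, h1], z, hz, h3⟩
  · exact absurd (hab.trans hbc) (lt_asymm hac)
  · obtain ⟨h1, h2, h3⟩ := sorted hz hx hy hxz.symm hyz.symm hxy hc ha hb hct hat hbt hac hab
    exact ⟨by rw [h2, ← h1, sup_comm], by rw [sup_comm, ← h1, sup_comm], x, hx, h3⟩
  · obtain ⟨h1, h2, h3⟩ := sorted hy hx hz hxy.symm hyz hxz hb ha hc hbt hat hct hab hac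
    exact ⟨by rw [sup_comm, h1, h2], h2.symm, x, hx, h3⟩
  · exact absurd (hac.trans hbc) (lt_asymm hab)
  · obtain ⟨h1, h2, h3⟩ := sorted hy hz hx hyz hxy.symm hxz.symm hb hc ha hbt hct hat hbc hac
    exact ⟨by rw [sup_comm, ← h2, sup_comm], by rw [h1, ← h2, sup_comm], z, hz, h3⟩
  · obtain ⟨h1, h2, h3⟩ := sorted hz hy hx hyz.symm hxz.symm hxy.symm hc hb ha hct hbt hat hbc hab
    exact ⟨by rw [sup_comm, h2, sup_comm], by rw [sup_comm, h1, sup_comm], y, hy, h3⟩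

omit hp in
-- Reflection in the horizontal axis turns the diagram upside down.
theorem IsPlanar.orderDual (hL : IsPlanar L) : IsPlanar Lᵒᵈ := by
  obtain ⟨p, hp⟩ := hL
  let e : (ℝ × ℝ) ≃ₗ[ℝ] ℝ × ℝ := (LinearEquiv.refl ℝ ℝ).prodCongr (LinearEquiv.neg ℝ)
  have hseg : ∀ a b : L, segment ℝ (e (p a)) (e (p b)) = e '' segment ℝ (p b) (p a) := by
    intro a b
    rw [segment_symm]
    exact (image_segment ℝ e.toLinearMap.toAffineMap _ _).symm
  refine ⟨fun a => e (p (OrderDual.ofDual a)), ?_, ?_, ?_, ?_⟩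
  · exact e.injective.comp (hp.injective.comp OrderDual.ofDual.injective)
  · intro a b hab
    exact neg_lt_neg (hp.upward _ _ hab.ofDual)
  · intro a b c hab hca hcb hc
    rw [hseg] at hc
    obtain ⟨q, hq, hqc⟩ := hc
    exact hp.avoids _ _ _ hab.ofDual hcb hca (e.injective hqc ▸ hq)
  · rintro a b c d hab hcd hne q ⟨h1, h2⟩
    rw [hseg] at h1 h2
    obtain ⟨r, hr, rfl⟩ := h1
    obtain ⟨s, hs, hsr⟩ := h2
    obtain rfl := e.injective hsr
    obtain ⟨v, ⟨hv1, hv2⟩, rfl⟩ := hp.noncrossing _ _ _ _ hab.ofDual hcd.ofDual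
      (by rintro ⟨⟩; exact hne rfl) ⟨hr, hs⟩
    exact ⟨OrderDual.toDual v, ⟨hv1.symm, hv2.symm⟩, rfl⟩

omit hp in
/-- In a finite planar modular lattice, an element with three upper covers is the bottom of a
decoration site with a trinket. -/
theorem exists_trinket [Finite L] [IsModularLattice L] (hL : IsPlanar L)
    {ι : Type*} [LinearOrder ι] (label : L ↪ ι) {o x y z : L}
    (hx : o ⋖ x) (hy : o ⋖ y) (hz : o ⋖ z) (hxy : x ≠ y) (hxz : x ≠ z) (hyz : y ≠ z) :
    ∃ i, IsDecorationSite o i ∧ (trinkets label o i).Nonempty := by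
  have hcov : ∀ w, o ⋖ w → w ⋖ x ⊔ y := by
    intro w hw
    by_cases hwx : w = x
    · rw [hwx]
      exact CovBy.sup_of_covBy_of_ne hx hy hxy
    by_cases hwy : w = y
    · rw [hwy, sup_comm]
      exact CovBy.sup_of_covBy_of_ne hy hx hxy.symm
    · obtain ⟨h1, -⟩ := sup_eq_and_exists_isDoublyIrreducible hL hx hy hw hxy (Ne.symm hwx)
        (Ne.symm hwy)
      rw [h1, sup_comm]
      exact CovBy.sup_of_covBy_of_ne hw hx hwx
  have hinf : x ⊓ y = o :=
    (hx.eq_or_eq (le_inf hx.le hy.le) inf_le_left).resolve_right fun h =>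
      (hy.eq_or_eq hx.le (inf_eq_left.1 h)).elim hx.ne' hxy
  have hcov' : ∀ w, w ⋖ x ⊔ y → o ⋖ w := by
    intro w hw
    by_cases hwx : w = x
    · exact hwx ▸ hx
    by_cases hwy : w = y
    · exact hwy ▸ hy
    -- In the dual lattice `x`, `y`, `w` are three upper covers of `x ⊔ y`, so `x ⊓ w = x ⊓ y = o`.
    · have hsup := sup_eq_and_exists_isDoublyIrreducible hL.orderDual
        (hcov x hx).toDual (hcov y hy).toDual hw.toDual hxy (Ne.symm hwx) (Ne.symm hwy)
      have h1 : x ⊓ y = x ⊓ w := hsup.1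
      have h2 := CovBy.sup_of_covBy_of_ne hw.toDual (hcov x hx).toDual hwx
      have h3 : w ⊓ x ⋖ w := h2.ofDual
      rwa [inf_comm, ← h1, hinf] at h3
  have hthree : 2 < (upperCovers o).ncard :=
    (Set.two_lt_ncard_iff (Set.toFinite _)).2 ⟨x, y, z, hx, hy, hz, hxy, hxz, hyz⟩
  refine ⟨x ⊔ y, ⟨Set.ext fun w => ⟨hcov w, hcov' w⟩, hthree.le⟩, ?_⟩
  obtain ⟨-, -, w, hw, hdi⟩ := sup_eq_and_exists_isDoublyIrreducible hL hx hy hz hxy hxz hyz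
  have hwmem : w ∈ doublyIrreduciblesBetween o (x ⊔ y) := ⟨⟨hw.lt, (hcov w hw).lt⟩, hdi⟩
  -- The highest-labeled candidate has none above it, so it is a trinket once the minimum is
  -- positive; three upper covers make `k - 2` positive.
  obtain ⟨m, hm, hmax⟩ := Set.exists_max_image (doublyIrreduciblesBetween o (x ⊔ y)) label
    (Set.toFinite _) ⟨w, hwmem⟩
  refine ⟨m, hm, ?_⟩
  have hempty : {s | s ∈ doublyIrreduciblesBetween o (x ⊔ y) ∧ label m < label s} = ∅ :=
    Set.eq_empty_iff_forall_notMem.2 fun s hs => (hmax s hs.1).not_gt hs.2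
  rw [hempty, Set.ncard_empty]
  exact lt_min ((Set.ncard_pos (Set.toFinite _)).2 ⟨w, hwmem⟩) (by omega)

end Planar

end LatticeRack

theorem corollary1 {L : Type*} [Lattice L] [Finite L] [IsModularLattice L]
    {ι : Type*} [LinearOrder ι] (label : L ↪ ι)
    (hrack : LatticeRack.IsRack label) (hplanar : LatticeRack.IsPlanar L) :
    ∀ x y z : L, x ⊓ (y ⊔ z) = (x ⊓ y) ⊔ (x ⊓ z) := by
  by_contra! h
  obtain ⟨x, y, z, h⟩ := h
  obtain ⟨o, a, b, c, ha, hb, hc, hab, hac, hbc⟩ := LatticeRack.exists_three_upperCovers h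
  obtain ⟨i, hsite, htrinket⟩ :=
    LatticeRack.exists_trinket hplanar label ha hb hc hab hac hbc
  exact htrinket.ne_empty (hrack o i hsite)
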